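/- Let $\omega(t)=\sqrt{1-t^2}$ on $[-1,1]$, and let $P_n(t)=\frac{(-1)^n}{2^n n!}\frac{d^n}{dt^n}\big((1-t^2)^n\big)$, $n\ge 0$, be the Legendre polynomials. For integers $0\le m\le n$ define the normalized associated Legendre functions \[ Q_n^m := \Big(\frac{2n+1}{2}\,\frac{(n-m)!}{(n+m)!}\Big)^{1/2}\,\omega^m\,P_n^{(m)} , \] and for integers $m\ge 0$, $k\ge 0$ define \[ H_m^k := \Big\{u\in L^2(-1,1)\;:\; \sum_{n=m}^\infty (2n+1)^{2k}\,\big|(u,Q_n^m)_{L^2(-1,1)}\big|^2<\infty\Big\}, \] where $L^2(-1,1)$ is the space of (classes of) real-valued square-integrable functions. Let $\mathcal C^\infty[-1,1]$ be the space of real-valued functions on $[-1,1]$ that are infinitely differentiable up to the end points. Then, for every integer $m\ge 0$, \[ \bigcap_{k=1}^\infty H_m^k=\{\omega^m g \;:\; g\in \mathcal C^\infty[-1,1]\}, \] as subsets of $L^2(-1,1)$. -/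

import Mathlib

open MeasureTheory
open scoped ContDiff

namespace LegendreScale

noncomputable section

/-- Lebesgue measure on the open interval `(-1, 1)`. -/
def mu : Measure ℝ := volume.restrict (Set.Ioo (-1) 1)

/-- The real Hilbert space `L²(-1, 1)`. -/
abbrev L2 : Type := Lp ℝ 2 mu

/-- The weight `ω(t) = √(1 - t²)`. -/
def omega (t : ℝ) : ℝ := Real.sqrt (1 - t ^ 2)

/-- The Legendre polynomial `P_n = (-1)^n / (2^n n!) * (d/dt)^n (1 - t²)^n`. -/
def legendreP (n : ℕ) : Polynomial ℝ :=
  Polynomial.C ((-1) ^ n / (2 ^ n * (n.factorial : ℝ))) *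
    Polynomial.derivative^[n] ((1 - Polynomial.X ^ 2) ^ n)

/-- The associated Legendre function `P_n^m = ω^m P_n^{(m)}`, for `m ≤ n`. -/
def assocLegendre (n m : ℕ) (t : ℝ) : ℝ :=
  omega t ^ m * (Polynomial.derivative^[m] (legendreP n)).eval t

/-- The normalizing constant `c_{n,m}`, for `m ≤ n`
(so that the subtraction of natural numbers is the true one). -/
def normConst (n m : ℕ) : ℝ :=
  Real.sqrt ((2 * (n : ℝ) + 1) / 2 * (((n - m).factorial : ℝ) / ((n + m).factorial : ℝ)))

/-- The normalized associated Legendre function `Q_n^m = c_{n,m} P_n^m`, for `m ≤ n`. -/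
def legendreQ (n m : ℕ) (t : ℝ) : ℝ := normConst n m * assocLegendre n m t

/-- The coefficient `(u, Q_n^m)` in `L²(-1, 1)`. -/
def coeff (m n : ℕ) (u : L2) : ℝ := ∫ t, u t * legendreQ n m t ∂mu

/-- The space `H_m^k`, for integers `m, k ≥ 0`: all `u ∈ L²(-1, 1)` with
`∑_{n ≥ m} (2n+1)^{2k} |(u, Q_n^m)|² < ∞`. -/
def H (m k : ℕ) : Set L2 :=
  {u | Summable fun n : Set.Ici m =>
    (2 * ((n : ℕ) : ℝ) + 1) ^ (2 * k) * |coeff m (n : ℕ) u| ^ 2}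

/-- The set `{ω^m g : g ∈ C^∞[-1, 1]}`, as a subset of `L²(-1, 1)`. -/
def omegaSmooth (m : ℕ) : Set L2 :=
  {u | ∃ g : ℝ → ℝ, ContDiffOn ℝ ∞ g (Set.Icc (-1) 1) ∧
    (u : ℝ → ℝ) =ᵐ[mu] fun t => omega t ^ m * g t}

end

end LegendreScale

namespace LegendreScale

open Polynomial

/-! Both sides describe the same `u`: those whose coefficients decay faster than every power of
`2n+1`. For the intersection of the `H m k` this is elementary (`coeff_decay_of_mem_H`,
`mem_H_of_coeff_decay`).

Smooth implies decay: `y = P_n^{(m)}` satisfies `-((1-t²)^(m+1) y')' = λ (1-t²)^m y` with `λ =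
(n-m)(n+m+1)`. Two integrations by parts, whose boundary terms vanish with the weight, move `λ` onto
`g` as a differential operator that preserves smoothness. Iterating gives `pairing_decay`.

Decay implies smooth: the candidate is `g = ∑ b_i P_{m+i}^{(m)}`. All its termwise derivatives
converge uniformly on `[-1,1]`, so `g` is smooth (`contDiffOn_legendreSeries`). By orthogonality
`ω^m g` has the coefficients of `u`, and by completeness it equals `u` (`ae_eq_of_coeff_eq`).

Both directions rest on the uniform bound `abs_eval_legendreD_le`, polynomial in `n`. -/

/-! ### The Legendre differential equation -/

/-- With `w = (1-x²)^n`, differentiate `(1-x²) w' = -2n x w` once for `k = 0`, then once more at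
each step. -/
theorem rodrigues_ode (n k : ℕ) :
    (1 - X ^ 2 : ℝ[X]) * derivative^[k + 2] ((1 - X ^ 2) ^ n)
      + C (2 * (n : ℝ) - 2 - 2 * k) * X * derivative^[k + 1] ((1 - X ^ 2) ^ n)
      + C (((k : ℝ) + 1) * (2 * n - k)) * derivative^[k] ((1 - X ^ 2) ^ n) = 0 := by
  induction k with
  | zero =>
    have h : (1 - X ^ 2 : ℝ[X]) * derivative ((1 - X ^ 2) ^ n)
        = -(C (2 * (n : ℝ)) * X * (1 - X ^ 2) ^ n) := by
      cases n with
      | zero => simp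
      | succ n =>
        simp only [derivative_pow, derivative_sub, derivative_one]
        simp
        ring
    have h' := congrArg derivative h
    simp only [derivative_mul, derivative_neg, derivative_sub, derivative_one, derivative_X_pow,
      derivative_C, derivative_X] at h'
    simp only [Function.iterate_succ, Function.iterate_zero, Function.comp, id]
    simp at h' ⊢
    linear_combination h'
  | succ k ih =>
    have h := congrArg derivative ih
    simp only [derivative_add, derivative_mul, derivative_sub, derivative_one, derivative_X_pow,
      derivative_C, derivative_X, derivative_zero, ← Function.iterate_succ_apply'] at h
    simp only [Nat.succ_eq_add_one] at h
    have h2 : (C (2 : ℝ)) = 2 := rfl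
    simp [h2] at h ⊢
    linear_combination h

/-- The derivative `P_n^{(m)}` of the Legendre polynomial. -/
noncomputable def legendreD (m n : ℕ) : ℝ[X] := derivative^[m] (legendreP n)

theorem derivative_legendreD (m n : ℕ) : derivative (legendreD m n) = legendreD (m + 1) n := by
  simp [legendreD, Function.iterate_succ_apply']

theorem legendreD_eq (m n : ℕ) : legendreD m n =
    C ((-1) ^ n / (2 ^ n * (n.factorial : ℝ))) * derivative^[m + n] ((1 - X ^ 2) ^ n) := by
  rw [legendreD, legendreP, iterate_derivative_C_mul, Function.iterate_add_apply]

theorem legendreD_ode (m n : ℕ) :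
    (1 - X ^ 2) * legendreD (m + 2) n - C (2 * ((m : ℝ) + 1)) * X * legendreD (m + 1) n
      + C (((n : ℝ) - m) * (n + m + 1)) * legendreD m n = 0 := by
  have h := rodrigues_ode n (m + n)
  simp only [legendreD_eq]
  rw [show m + 2 + n = m + n + 2 by ring, show m + 1 + n = m + n + 1 by ring]
  have e1 : (2 * (n : ℝ) - 2 - 2 * ((m + n : ℕ) : ℝ)) = -(2 * ((m : ℝ) + 1)) := by
    push_cast; ring
  have e2 : (((m + n : ℕ) : ℝ) + 1) * (2 * n - ((m + n : ℕ) : ℝ))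
      = ((n : ℝ) - m) * (n + m + 1) := by
    push_cast; ring
  rw [e1, e2, C_neg] at h
  linear_combination C ((-1) ^ n / (2 ^ n * (n.factorial : ℝ))) * h

/-! ### Degrees and endpoint values -/

theorem natDegree_one_sub_X_sq_pow (n : ℕ) : ((1 - X ^ 2 : ℝ[X]) ^ n).natDegree = 2 * n := by
  have h : (1 - X ^ 2 : ℝ[X]).natDegree = 2 := by compute_degree!
  rw [natDegree_pow, h, mul_comm]

theorem natDegree_iterate_derivative_eq (p : ℝ[X]) (k : ℕ) :
    (derivative^[k] p).natDegree = p.natDegree - k := by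
  induction k with
  | zero => simp
  | succ k ih =>
    rw [Function.iterate_succ_apply', natDegree_derivative, ih]
    omega

theorem natDegree_legendreD (m n : ℕ) : (legendreD m n).natDegree = n - m := by
  rw [legendreD_eq, natDegree_C_mul (by positivity), natDegree_iterate_derivative_eq,
    natDegree_one_sub_X_sq_pow]
  omega

/-- Since `(1-x²)^n = (x-1)^n (-(1+x))^n`, the `n`-th derivative at `1` is `n!` times the cofactor
there. -/
theorem eval_legendreP_one (n : ℕ) : (legendreP n).eval 1 = 1 := by
  have h := aeval_iterate_derivative_self (A := ℝ) ((1 - X ^ 2 : ℝ[X]) ^ n) n 1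
    (p' := (-(1 + X)) ^ n) (by simp [← mul_pow]; ring)
  simp only [coe_aeval_eq_eval] at h
  simp only [legendreP, eval_mul, eval_C, h]
  simp
  have := n.factorial_ne_zero
  field_simp
  rw [show (-1 + -1 : ℝ) = (-1) * 2 by norm_num, mul_pow, ← mul_assoc, ← mul_pow]
  norm_num

theorem eval_legendreP_neg_one (n : ℕ) : (legendreP n).eval (-1) = (-1) ^ n := by
  have h := aeval_iterate_derivative_self (A := ℝ) ((1 - X ^ 2 : ℝ[X]) ^ n) n (-1)
    (p' := (1 - X) ^ n) (by simp [← mul_pow]; ring)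
  simp only [coe_aeval_eq_eval] at h
  simp only [legendreP, eval_mul, eval_C, h]
  simp
  have := n.factorial_ne_zero
  field_simp
  norm_num

theorem legendreD_eq_zero {m n : ℕ} (h : n < m) : legendreD m n = 0 :=
  iterate_derivative_eq_zero ((natDegree_legendreD 0 n).trans_lt (by omega))

theorem legendreD_ne_zero {m n : ℕ} (h : m ≤ n) : legendreD m n ≠ 0 := by
  cases m with
  | zero =>
    intro h0
    have := eval_legendreP_one n
    rw [show legendreP n = legendreD 0 n from rfl, h0] at this
    simp at this
  | succ m =>
    intro h0
    rw [← derivative_legendreD] at h0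
    have := derivative_eq_zero.1 h0
    rw [natDegree_legendreD] at this
    omega

theorem legendreD_ode_eval (m n : ℕ) (t : ℝ) :
    (1 - t ^ 2) * (legendreD (m + 2) n).eval t - 2 * (m + 1) * t * (legendreD (m + 1) n).eval t
      + (n - m) * (n + m + 1) * (legendreD m n).eval t = 0 := by
  simpa using congrArg (eval t) (legendreD_ode m n)

/-! ### Uniform bounds on `[-1,1]` -/

/-- At `t = ±1` the leading term of the equation drops out, leaving a first-order recursion in `m`
whose factor is at most `(2n+1)²`. -/
theorem abs_eval_legendreD_endpoint_le (m n : ℕ) {t : ℝ} (ht : t = 1 ∨ t = -1) :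
    |(legendreD m n).eval t| ≤ (2 * n + 1) ^ (2 * m) := by
  have hsq : t ^ 2 = 1 := by rcases ht with rfl | rfl <;> norm_num
  have habs : |t| = 1 := by rcases ht with rfl | rfl <;> norm_num
  induction m with
  | zero =>
    rcases ht with rfl | rfl
    · simp [show legendreD 0 n = legendreP n from rfl, eval_legendreP_one]
    · simp [show legendreD 0 n = legendreP n from rfl, eval_legendreP_neg_one]
  | succ m ih =>
    rcases lt_or_ge n m with h | h
    · rw [legendreD_eq_zero (by omega : n < m + 1), eval_zero, abs_zero]
      positivity
    have hmn : (m : ℝ) ≤ n := by exact_mod_cast h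
    have hm : (0 : ℝ) ≤ m := by positivity
    have e : 2 * ((m : ℝ) + 1) * (t * (legendreD (m + 1) n).eval t)
        = (n - m) * (n + m + 1) * (legendreD m n).eval t := by
      have := legendreD_ode_eval m n t
      rw [hsq] at this
      linarith
    have e' := congrArg abs e
    have hl : 0 ≤ ((n : ℝ) - m) * (n + m + 1) := mul_nonneg (by linarith) (by positivity)
    rw [abs_mul, abs_mul t, habs, one_mul, abs_of_nonneg (by positivity), abs_mul,
      abs_of_nonneg hl] at e'
    calc |(legendreD (m + 1) n).eval t|
        ≤ 2 * ((m : ℝ) + 1) * |(legendreD (m + 1) n).eval t| :=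
          le_mul_of_one_le_left (abs_nonneg _) (by linarith)
      _ = (n - m) * (n + m + 1) * |(legendreD m n).eval t| := e'
      _ ≤ (2 * n + 1) ^ 2 * (2 * n + 1) ^ (2 * m) := by
          refine mul_le_mul ?_ ih (abs_nonneg _) (by positivity)
          nlinarith
      _ = (2 * n + 1) ^ (2 * (m + 1)) := by ring

/-- The energy `λ y² + (1 - t²) y'²` of `y = P_n^{(m)}`, with `λ = (n - m)(n + m + 1)`. -/
noncomputable def energy (m n : ℕ) : ℝ[X] :=
  C (((n : ℝ) - m) * (n + m + 1)) * legendreD m n ^ 2 + (1 - X ^ 2) * legendreD (m + 1) n ^ 2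

theorem derivative_energy (m n : ℕ) :
    derivative (energy m n) = C (4 * (m : ℝ) + 2) * X * legendreD (m + 1) n ^ 2 := by
  have h := legendreD_ode m n
  have e : (C (4 * (m : ℝ) + 2) : ℝ[X]) = 2 * C (2 * ((m : ℝ) + 1)) - 2 := by
    rw [show (2 : ℝ[X]) = C 2 from rfl, ← C_mul, ← C_sub]
    congr 1
    ring
  rw [e]
  simp only [energy, derivative_add, derivative_mul, derivative_pow, derivative_legendreD,
    derivative_C, derivative_sub, derivative_one, derivative_X, zero_mul, zero_add, zero_sub,
    Nat.cast_ofNat, Nat.add_one_sub_one, pow_one, mul_one, map_ofNat]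
  linear_combination 2 * legendreD (m + 1) n * h

/-- The derivative of the energy has the sign of `t`, so the energy grows towards both endpoints. -/
theorem eval_energy_le (m n : ℕ) {t : ℝ} (ht : t ∈ Set.Icc (-1 : ℝ) 1) :
    (energy m n).eval t ≤ (energy m n).eval 1 ∨ (energy m n).eval t ≤ (energy m n).eval (-1) := by
  have hd : ∀ x : ℝ, deriv (fun s => (energy m n).eval s) x
      = (4 * m + 2) * x * (legendreD (m + 1) n).eval x ^ 2 := fun x => by
    simp [Polynomial.deriv, derivative_energy]
  rcases le_total 0 t with h | h
  · left
    refine monotoneOn_of_deriv_nonneg (convex_Icc (0 : ℝ) 1) (energy m n).continuousOn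
      (energy m n).differentiable.differentiableOn (fun x hx => ?_) ⟨h, ht.2⟩ ⟨zero_le_one, le_rfl⟩
      ht.2
    rw [interior_Icc] at hx
    rw [hd]
    have := hx.1
    positivity
  · right
    refine antitoneOn_of_deriv_nonpos (convex_Icc (-1 : ℝ) 0) (energy m n).continuousOn
      (energy m n).differentiable.differentiableOn (fun x hx => ?_)
      ⟨le_rfl, by norm_num⟩ ⟨ht.1, h⟩ ht.1
    rw [interior_Icc] at hx
    rw [hd]
    refine mul_nonpos_of_nonpos_of_nonneg ?_ (sq_nonneg _)
    exact mul_nonpos_of_nonneg_of_nonpos (by positivity) hx.2.le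

/-- The energy dominates `λ y²` and equals it at `±1`, which reduces the bound to the endpoints.
Cancelling `λ` needs `m < n`; for `n = m` the polynomial is constant. -/
theorem abs_eval_legendreD_le (m n : ℕ) {t : ℝ} (ht : t ∈ Set.Icc (-1 : ℝ) 1) :
    |(legendreD m n).eval t| ≤ (2 * n + 1) ^ (2 * m) := by
  rcases lt_trichotomy n m with h | rfl | h
  · rw [legendreD_eq_zero h, eval_zero, abs_zero]
    positivity
  · have hc := eq_C_of_natDegree_eq_zero (p := legendreD n n) (by simp [natDegree_legendreD])
    have h1 := abs_eval_legendreD_endpoint_le n n (t := 1) (Or.inl rfl)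
    rw [hc, eval_C] at h1 ⊢
    exact h1
  · have hmn : (m : ℝ) < n := by exact_mod_cast h
    have hl : 0 < ((n : ℝ) - m) * (n + m + 1) := mul_pos (by linarith) (by positivity)
    have key : ∀ s : ℝ, (s = 1 ∨ s = -1) → (energy m n).eval t ≤ (energy m n).eval s →
        |(legendreD m n).eval t| ≤ (2 * n + 1) ^ (2 * m) := fun s hs hle => by
      refine (sq_le_sq.1 ?_).trans (abs_eval_legendreD_endpoint_le m n hs)
      have hsq : s ^ 2 = 1 := by rcases hs with rfl | rfl <;> norm_num
      simp only [energy, eval_add, eval_mul, eval_C, eval_pow, eval_sub, eval_one, eval_X, hsq,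
        sub_self, zero_mul, add_zero] at hle
      have : 0 ≤ (1 - t ^ 2) * (legendreD (m + 1) n).eval t ^ 2 :=
        mul_nonneg (by nlinarith [ht.1, ht.2]) (sq_nonneg _)
      exact le_of_mul_le_mul_left (by linarith) hl
    rcases eval_energy_le m n ht with h' | h'
    · exact key 1 (Or.inl rfl) h'
    · exact key (-1) (Or.inr rfl) h'

/-! ### The weighted pairing and integration by parts -/

/-- The weighted pairing `∫ (1 - t²)^m g P_n^{(m)}` over `[-1, 1]`. -/
noncomputable def pairing (m n : ℕ) (g : ℝ → ℝ) : ℝ :=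
  ∫ t in (-1 : ℝ)..1, (1 - t ^ 2) ^ m * g t * (legendreD m n).eval t

theorem derivative_weight_mul_legendreD (m n : ℕ) :
    derivative ((1 - X ^ 2) ^ (m + 1) * legendreD (m + 1) n)
      = -(C (((n : ℝ) - m) * (n + m + 1)) * ((1 - X ^ 2) ^ m * legendreD m n)) := by
  have h := legendreD_ode m n
  have e : (C (2 * ((m : ℝ) + 1)) : ℝ[X]) = 2 * ((m : ℝ[X]) + 1) := by
    simp [show (C (2 : ℝ)) = 2 from rfl]
  rw [e] at h
  simp only [derivative_mul, derivative_pow_succ, derivative_legendreD, derivative_sub,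
    derivative_one, derivative_X, map_add, map_natCast, map_one,
    zero_sub]
  linear_combination (1 - X ^ 2) ^ m * h

theorem derivative_weight (m : ℕ) :
    derivative ((1 - X ^ 2 : ℝ[X]) ^ (m + 1))
      = -(C (2 * ((m : ℝ) + 1)) * X * (1 - X ^ 2) ^ m) := by
  have e : (C (2 * ((m : ℝ) + 1)) : ℝ[X]) = 2 * ((m : ℝ[X]) + 1) := by
    simp [show (C (2 : ℝ)) = 2 from rfl]
  rw [e]
  simp only [derivative_pow_succ, derivative_sub,
    derivative_one, derivative_X, map_add, map_natCast, map_one,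
    zero_sub]
  ring

theorem uIcc_neg_one_one : Set.uIcc (-1 : ℝ) 1 = Set.Icc (-1) 1 :=
  Set.uIcc_of_le (by norm_num)

theorem pairing_succ_deriv (m n : ℕ) {f f' : ℝ → ℝ}
    (hf : ∀ t ∈ Set.Icc (-1 : ℝ) 1, HasDerivWithinAt f (f' t) (Set.Icc (-1) 1) t)
    (hf' : ContinuousOn f' (Set.Icc (-1) 1)) :
    pairing (m + 1) n f' = (n - m) * (n + m + 1) * pairing m n f := by
  set V : ℝ[X] := (1 - X ^ 2) ^ (m + 1) * legendreD (m + 1) n with hV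
  have h := intervalIntegral.integral_mul_deriv_eq_deriv_mul_of_hasDerivWithinAt
    (a := -1) (b := 1) (u := f) (u' := f') (v := fun t => V.eval t)
    (v' := fun t => (derivative V).eval t)
    (by rwa [uIcc_neg_one_one]) (fun x _ => (V.hasDerivAt x).hasDerivWithinAt)
    (ContinuousOn.intervalIntegrable (by rwa [uIcc_neg_one_one]))
    ((derivative V).continuous.intervalIntegrable _ _)
  rw [hV, derivative_weight_mul_legendreD] at h
  simp only [eval_mul, eval_pow, eval_sub, eval_one, eval_X, eval_C, eval_neg] at h
  norm_num at h
  rw [pairing, pairing, ← intervalIntegral.integral_const_mul]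
  exact (intervalIntegral.integral_congr fun t _ => by ring).trans
    (h.symm.trans (intervalIntegral.integral_congr fun t _ => by ring))

theorem pairing_succ_eq (m n : ℕ) {g g' : ℝ → ℝ}
    (hg : ∀ t ∈ Set.Icc (-1 : ℝ) 1, HasDerivWithinAt g (g' t) (Set.Icc (-1) 1) t)
    (hg' : ContinuousOn g' (Set.Icc (-1) 1)) :
    pairing (m + 1) n g
      = pairing m n fun t => 2 * (m + 1) * t * g t - (1 - t ^ 2) * g' t := by
  set W : ℝ[X] := (1 - X ^ 2) ^ (m + 1) with hW
  have hgc : ContinuousOn g (Set.Icc (-1) 1) := fun t ht => (hg t ht).continuousWithinAt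
  have h := intervalIntegral.integral_mul_deriv_eq_deriv_mul_of_hasDerivWithinAt
    (a := -1) (b := 1) (u := fun t => W.eval t * g t)
    (u' := fun t => (derivative W).eval t * g t + W.eval t * g' t)
    (v := fun t => (legendreD m n).eval t)
    (v' := fun t => (legendreD (m + 1) n).eval t)
    (fun x hx => (W.hasDerivAt x).hasDerivWithinAt.mul
      (by rw [uIcc_neg_one_one] at hx ⊢; exact hg x hx))
    (fun x _ => by
      rw [← derivative_legendreD]; exact ((legendreD m n).hasDerivAt x).hasDerivWithinAt)
    (ContinuousOn.intervalIntegrable (by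
      rw [uIcc_neg_one_one]
      exact ((derivative W).continuousOn.mul hgc).add (W.continuousOn.mul hg')))
    ((legendreD (m + 1) n).continuous.intervalIntegrable _ _)
  rw [hW, derivative_weight] at h
  simp only [eval_mul, eval_pow, eval_sub, eval_one, eval_X, eval_C, eval_neg] at h
  rw [pairing, pairing, h]
  norm_num
  rw [← intervalIntegral.integral_neg]
  refine intervalIntegral.integral_congr fun t _ => ?_
  ring

/-! ### Orthogonality and normalization -/

theorem pairing_succ_legendreD (m k n : ℕ) :
    pairing (m + 1) n (fun t => (legendreD (m + 1) k).eval t)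
      = (n - m) * (n + m + 1) * pairing m n (fun t => (legendreD m k).eval t) :=
  pairing_succ_deriv m n (fun t _ => by
    rw [← derivative_legendreD]; exact ((legendreD m k).hasDerivAt t).hasDerivWithinAt)
    (legendreD (m + 1) k).continuousOn

theorem pairing_legendreD_comm (m k n : ℕ) :
    pairing m n (fun t => (legendreD m k).eval t) = pairing m k (fun t => (legendreD m n).eval t) :=
  intervalIntegral.integral_congr fun t _ => by ring

/-- The pairing at level `m + 1` is symmetric in `k` and `n`, so both eigenvalues multiply the same
integral; they differ by `(k-n)(k+n+1)`. -/
theorem pairing_legendreD_of_ne {m k n : ℕ} (hkn : k ≠ n) :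
    pairing m n (fun t => (legendreD m k).eval t) = 0 := by
  have h1 := pairing_succ_legendreD m k n
  have h2 := pairing_succ_legendreD m n k
  rw [pairing_legendreD_comm, h2, pairing_legendreD_comm m n k] at h1
  have h3 : (((k : ℝ) - n) * (k + n + 1)) * pairing m n (fun t => (legendreD m k).eval t) = 0 := by
    linear_combination h1
  refine (mul_eq_zero.1 h3).resolve_left (mul_ne_zero ?_ (by positivity))
  rw [sub_ne_zero]
  exact_mod_cast hkn

/-- The polynomials `P_{m+i}^{(m)}`, of degree `i`. -/
noncomputable def legendreDSequence (m : ℕ) : Polynomial.Sequence ℝ where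
  elems' i := legendreD m (m + i)
  degree_eq' i := by
    rw [degree_eq_natDegree (legendreD_ne_zero (by omega)), natDegree_legendreD]
    simp

theorem legendreDSequence_apply (m i : ℕ) : legendreDSequence m i = legendreD m (m + i) := rfl

theorem isUnit_leadingCoeff_legendreDSequence (m i : ℕ) :
    IsUnit (legendreDSequence m i).leadingCoeff :=
  (leadingCoeff_ne_zero.2 ((legendreDSequence m).ne_zero i)).isUnit

theorem pairing_zero_of_degree_lt {n : ℕ} {p : ℝ[X]} (hp : p.degree < n) :
    pairing 0 n (fun t => p.eval t) = 0 := by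
  rw [← mem_degreeLT, ← (legendreDSequence 0).span_degreeLT
    fun i _ => isUnit_leadingCoeff_legendreDSequence 0 i] at hp
  induction hp using Submodule.span_induction with
  | mem q hq =>
    obtain ⟨i, hi, rfl⟩ := hq
    rw [legendreDSequence_apply, zero_add]
    exact pairing_legendreD_of_ne (ne_of_lt hi)
  | zero => simp [pairing]
  | add q r _ _ hq hr =>
    simp only [pairing, pow_zero, one_mul, eval_add, add_mul] at hq hr ⊢
    rw [intervalIntegral.integral_add, hq, hr, add_zero]
    · exact (q.continuous.mul (legendreD 0 n).continuous).intervalIntegrable _ _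
    · exact (r.continuous.mul (legendreD 0 n).continuous).intervalIntegrable _ _
  | smul c q _ hq =>
    simp only [pairing, pow_zero, one_mul, eval_smul, smul_eq_mul, mul_assoc] at hq ⊢
    rw [intervalIntegral.integral_const_mul, hq, mul_zero]

theorem coeff_X_mul_derivative (p : ℝ[X]) (k : ℕ) :
    (X * derivative p).coeff k = k * p.coeff k := by
  cases k with
  | zero => simp
  | succ k =>
    rw [coeff_X_mul, coeff_derivative]
    push_cast
    ring

/-- Integrate `(xP²)' = 2P(xP' - nP) + (2n+1)P²`: the boundary values give `2`, and `xP' - nP` has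
degree below `n`, hence is orthogonal to `P`. -/
theorem pairing_zero_self (n : ℕ) :
    pairing 0 n (fun t => (legendreD 0 n).eval t) = 2 / (2 * n + 1) := by
  set P := legendreD 0 n with hP
  have hdeg : (X * derivative P - (n : ℝ[X]) * P).degree < (n : WithBot ℕ) := by
    rw [degree_lt_iff_coeff_zero]
    intro k hk
    rw [coeff_sub, coeff_X_mul_derivative, coeff_natCast_mul]
    rcases hk.eq_or_lt with rfl | h
    · simp
    · rw [coeff_eq_zero_of_natDegree_lt (p := P) (by rw [hP, natDegree_legendreD]; omega)]
      simp
  have h1 := pairing_zero_of_degree_lt hdeg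
  have h2 : ∫ t in (-1 : ℝ)..1, (derivative (X * P ^ 2)).eval t
      = (X * P ^ 2).eval 1 - (X * P ^ 2).eval (-1) :=
    intervalIntegral.integral_eq_sub_of_hasDerivAt (fun t _ => (X * P ^ 2).hasDerivAt t)
      ((derivative (X * P ^ 2)).continuous.intervalIntegrable _ _)
  have e1 : P.eval 1 = 1 := eval_legendreP_one n
  have e2 : P.eval (-1) = (-1) ^ n := eval_legendreP_neg_one n
  have h3 : ∫ t in (-1 : ℝ)..1, (derivative (X * P ^ 2)).eval t
      = 2 * pairing 0 n (fun t => (X * derivative P - (n : ℝ[X]) * P).eval t)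
        + (2 * n + 1) * pairing 0 n (fun t => P.eval t) := by
    simp only [pairing, pow_zero, one_mul]
    rw [← intervalIntegral.integral_const_mul, ← intervalIntegral.integral_const_mul,
      ← intervalIntegral.integral_add]
    · refine intervalIntegral.integral_congr fun t _ => ?_
      simp only [derivative_mul, derivative_X, derivative_pow, eval_add, eval_mul, eval_sub,
        eval_X, eval_one, eval_pow, eval_natCast, ← hP]
      simp
      ring
    · exact (continuous_const.mul ((Polynomial.continuous _).mul
        (Polynomial.continuous _))).intervalIntegrable _ _
    · exact (continuous_const.mul ((Polynomial.continuous _).mul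
        (Polynomial.continuous _))).intervalIntegrable _ _
  rw [h2, h1] at h3
  simp only [eval_mul, eval_X, eval_pow, e1, e2, ← pow_mul, mul_comm n 2] at h3
  rw [eq_div_iff (by positivity)]
  norm_num at h3
  linarith

theorem pairing_self {m n : ℕ} (h : m ≤ n) :
    pairing m n (fun t => (legendreD m n).eval t)
      = ((n + m).factorial : ℝ) / ((n - m).factorial : ℝ) * (2 / (2 * n + 1)) := by
  induction m with
  | zero =>
    rw [pairing_zero_self]
    have := n.factorial_ne_zero
    simp
    field_simp
  | succ m ih =>
    obtain ⟨r, rfl⟩ := Nat.exists_eq_add_of_le h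
    rw [pairing_succ_legendreD, ih (by omega), show m + 1 + r - m = r + 1 by omega,
      show m + 1 + r - (m + 1) = r by omega,
      show m + 1 + r + (m + 1) = (m + 1 + r + m) + 1 by ring, Nat.factorial_succ r,
      Nat.factorial_succ (m + 1 + r + m)]
    have := r.factorial_ne_zero
    have : ((r : ℝ) + 1) ≠ 0 := by positivity
    push_cast
    field_simp
    ring

theorem normConst_sq_mul_pairing_self {m n : ℕ} (h : m ≤ n) :
    normConst n m ^ 2 * pairing m n (fun t => (legendreD m n).eval t) = 1 := by
  have h1 := (n - m).factorial_ne_zero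
  have h2 := (n + m).factorial_ne_zero
  rw [pairing_self h, normConst, Real.sq_sqrt (by positivity)]
  field_simp

theorem normConst_nonneg (n m : ℕ) : 0 ≤ normConst n m := Real.sqrt_nonneg _

theorem normConst_le (n m : ℕ) : normConst n m ≤ 2 * n + 1 := by
  have h : (((n - m).factorial : ℝ) / ((n + m).factorial : ℝ)) ≤ 1 :=
    div_le_one_of_le₀ (by exact_mod_cast Nat.factorial_le (by omega)) (by positivity)
  have hn : (0 : ℝ) ≤ n := by positivity
  rw [normConst]
  refine Real.sqrt_le_iff.2 ⟨by positivity, ?_⟩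
  calc (2 * (n : ℝ) + 1) / 2 * (((n - m).factorial : ℝ) / ((n + m).factorial : ℝ))
      ≤ (2 * (n : ℝ) + 1) / 2 * 1 := by gcongr
    _ ≤ (2 * n + 1) ^ 2 := by nlinarith

/-! ### Smooth functions have rapidly decaying coefficients -/

theorem integral_mu (f : ℝ → ℝ) : ∫ t, f t ∂mu = ∫ t in (-1 : ℝ)..1, f t := by
  rw [intervalIntegral.integral_of_le (by norm_num), integral_Ioc_eq_integral_Ioo, mu]

theorem omega_sq {t : ℝ} (ht : t ∈ Set.Icc (-1 : ℝ) 1) : omega t ^ 2 = 1 - t ^ 2 :=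
  Real.sq_sqrt (by nlinarith [ht.1, ht.2])

theorem coeff_eq_of_ae_eq {m : ℕ} (n : ℕ) {u : L2} {g : ℝ → ℝ}
    (hu : (u : ℝ → ℝ) =ᵐ[mu] fun t => omega t ^ m * g t) :
    coeff m n u = normConst n m * pairing m n g := by
  rw [coeff, pairing, ← intervalIntegral.integral_const_mul, ← integral_mu]
  refine integral_congr_ae ?_
  have hmem : ∀ᵐ t ∂mu, t ∈ Set.Ioo (-1 : ℝ) 1 := ae_restrict_mem measurableSet_Ioo
  filter_upwards [hu, hmem] with t h ht
  rw [h, legendreQ, assocLegendre, ← omega_sq (Set.Ioo_subset_Icc_self ht)]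
  simp only [legendreD]
  ring

theorem uniqueDiffOn_Icc_neg_one_one : UniqueDiffOn ℝ (Set.Icc (-1 : ℝ) 1) :=
  uniqueDiffOn_Icc (by norm_num)

theorem exists_pairing_eigenvalue_mul (m : ℕ) {g : ℝ → ℝ}
    (hg : ContDiffOn ℝ ∞ g (Set.Icc (-1) 1)) :
    ∃ g₂ : ℝ → ℝ, ContDiffOn ℝ ∞ g₂ (Set.Icc (-1) 1) ∧
      ∀ n, (n - m) * (n + m + 1) * pairing m n g = pairing m n g₂ := by
  set I := Set.Icc (-1 : ℝ) 1
  obtain ⟨hd, hg'⟩ := (contDiffOn_infty_iff_derivWithin uniqueDiffOn_Icc_neg_one_one).1 hg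
  obtain ⟨hd', hg''⟩ := (contDiffOn_infty_iff_derivWithin uniqueDiffOn_Icc_neg_one_one).1 hg'
  refine ⟨fun t => 2 * (m + 1) * t * derivWithin g I t
    - (1 - t ^ 2) * derivWithin (derivWithin g I) I t, ?_, fun n => ?_⟩
  · exact ((contDiffOn_const.mul contDiffOn_id).mul hg').sub
      ((contDiffOn_const.sub (contDiffOn_id.pow 2)).mul hg'')
  · rw [← pairing_succ_deriv m n (fun t ht => (hd t ht).hasDerivWithinAt) hg'.continuousOn,
      pairing_succ_eq m n (fun t ht => (hd' t ht).hasDerivWithinAt) hg''.continuousOn]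

theorem abs_pairing_le (m n : ℕ) {g : ℝ → ℝ} {M : ℝ}
    (hM : ∀ t ∈ Set.Icc (-1 : ℝ) 1, |g t| ≤ M) :
    |pairing m n g| ≤ 2 * M * (2 * n + 1) ^ (2 * m) := by
  have hM0 : 0 ≤ M := (abs_nonneg _).trans (hM 0 (by norm_num))
  have h := intervalIntegral.norm_integral_le_of_norm_le_const (a := -1) (b := 1)
    (f := fun t : ℝ => (1 - t ^ 2) ^ m * g t * (legendreD m n).eval t)
    (C := M * (2 * n + 1) ^ (2 * m)) fun t ht => ?_
  · rw [pairing, ← Real.norm_eq_abs]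
    refine h.trans_eq ?_
    norm_num
    ring
  · rw [Set.uIoc_of_le (by norm_num)] at ht
    have ht' := Set.Ioc_subset_Icc_self ht
    have hw0 : 0 ≤ 1 - t ^ 2 := by nlinarith [ht.1, ht.2]
    have hw : |(1 - t ^ 2) ^ m| ≤ 1 := by
      rw [abs_of_nonneg (pow_nonneg hw0 m)]
      exact pow_le_one₀ hw0 (by nlinarith)
    rw [Real.norm_eq_abs, abs_mul, abs_mul]
    calc |(1 - t ^ 2) ^ m| * |g t| * |(legendreD m n).eval t|
        ≤ 1 * M * (2 * n + 1) ^ (2 * m) := by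
          gcongr
          · exact hM t ht'
          · exact abs_eval_legendreD_le m n ht'
      _ = _ := by ring

theorem pairing_decay (m j : ℕ) : ∀ {g : ℝ → ℝ}, ContDiffOn ℝ ∞ g (Set.Icc (-1) 1) →
    ∃ C : ℝ, ∀ n, m ≤ n →
      (2 * (n : ℝ) + 1) ^ j * |pairing m n g| ≤ C * (2 * n + 1) ^ (2 * m) := by
  induction j with
  | zero =>
    intro g hg
    obtain ⟨M, hM⟩ := isCompact_Icc.exists_bound_of_continuousOn hg.continuousOn
    exact ⟨2 * M, fun n _ => by simpa using abs_pairing_le m n hM⟩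
  | succ j ih =>
    intro g hg
    obtain ⟨g₂, hg₂, he⟩ := exists_pairing_eigenvalue_mul m hg
    obtain ⟨C, hC⟩ := ih hg₂
    -- The eigenvalue vanishes at `n = m`, so that index needs its own constant. For `n > m`, `2n+1
    -- ≤ (2m+3)λ`, with equality of `2n+1` and `(2m+3)(n-m)` at `n = m+1`.
    refine ⟨max ((2 * m + 3) * C) ((2 * (m : ℝ) + 1) ^ (j + 1) * |pairing m m g|),
      fun n hn => ?_⟩
    have hp : (1 : ℝ) ≤ (2 * n + 1) ^ (2 * m) :=
      one_le_pow₀ (by linarith [(Nat.cast_nonneg n : (0 : ℝ) ≤ n)])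
    rcases hn.eq_or_lt with rfl | h
    · exact (le_max_right _ _).trans (le_mul_of_one_le_right
        ((by positivity : 0 ≤ (2 * (m : ℝ) + 1) ^ (j + 1) * |pairing m m g|).trans
          (le_max_right _ _)) hp)
    · have h1 : (m : ℝ) + 1 ≤ n := by exact_mod_cast h
      have hm : (0 : ℝ) ≤ m := by positivity
      have hl : 0 ≤ ((n : ℝ) - m) * (n + m + 1) := mul_nonneg (by linarith) (by positivity)
      have hlam : 2 * (n : ℝ) + 1 ≤ (2 * m + 3) * ((n - m) * (n + m + 1)) := by
        have : 2 * (n : ℝ) + 1 ≤ (2 * m + 3) * (n - m) := by nlinarith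
        have h2 : (n : ℝ) - m ≤ (n - m) * (n + m + 1) :=
          le_mul_of_one_le_right (by linarith) (by linarith)
        exact this.trans (by gcongr)
      calc (2 * (n : ℝ) + 1) ^ (j + 1) * |pairing m n g|
          = (2 * (n : ℝ) + 1) ^ j * ((2 * n + 1) * |pairing m n g|) := by ring
        _ ≤ (2 * (n : ℝ) + 1) ^ j
              * ((2 * m + 3) * ((n - m) * (n + m + 1)) * |pairing m n g|) := by gcongr
        _ = (2 * m + 3) * ((2 * (n : ℝ) + 1) ^ j * |pairing m n g₂|) := by
            rw [← he n, abs_mul, abs_of_nonneg hl]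
            ring
        _ ≤ (2 * m + 3) * (C * (2 * n + 1) ^ (2 * m)) :=
            mul_le_mul_of_nonneg_left (hC n hn) (by positivity)
        _ = (2 * m + 3) * C * (2 * n + 1) ^ (2 * m) := by ring
        _ ≤ _ := by gcongr; exact le_max_left _ _

theorem coeff_decay_of_mem_omegaSmooth {m : ℕ} {u : L2} (hu : u ∈ omegaSmooth m) (k : ℕ) :
    ∃ C : ℝ, ∀ n, m ≤ n → (2 * (n : ℝ) + 1) ^ k * |coeff m n u| ≤ C := by
  obtain ⟨g, hg, hug⟩ := hu
  -- The extra `1` pays for `normConst_le`, the `2 * m` for the growth factor in `pairing_decay`.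
  obtain ⟨C, hC⟩ := pairing_decay m (k + 1 + 2 * m) hg
  refine ⟨C, fun n hn => ?_⟩
  rw [coeff_eq_of_ae_eq n hug, abs_mul, abs_of_nonneg (normConst_nonneg n m)]
  refine le_of_mul_le_mul_right ?_ (by positivity : 0 < (2 * (n : ℝ) + 1) ^ (2 * m))
  calc (2 * (n : ℝ) + 1) ^ k * (normConst n m * |pairing m n g|) * (2 * n + 1) ^ (2 * m)
      ≤ (2 * (n : ℝ) + 1) ^ k * ((2 * n + 1) * |pairing m n g|) * (2 * n + 1) ^ (2 * m) := by
        gcongr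
        exact normConst_le n m
    _ = (2 * (n : ℝ) + 1) ^ (k + 1 + 2 * m) * |pairing m n g| := by ring
    _ ≤ _ := hC n hn

/-! ### Weighted summability versus decay -/

theorem summable_const_div_sq (C : ℝ) : Summable fun n : ℕ => C / (2 * (n : ℝ) + 1) ^ 2 := by
  have h : Summable fun n : ℕ => 1 / ((n : ℝ) + 1) ^ 2 := by
    exact_mod_cast (summable_nat_add_iff 1).2 (Real.summable_one_div_nat_pow.2 one_lt_two)
  have h' : Summable fun n : ℕ => 1 / (2 * (n : ℝ) + 1) ^ 2 :=
    Summable.of_nonneg_of_le (fun n => by positivity)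
      (fun n => by gcongr; linarith [(Nat.cast_nonneg n : (0 : ℝ) ≤ n)]) h
  simpa [div_eq_mul_inv] using h'.mul_left C

theorem mem_H_of_coeff_decay {m : ℕ} {u : L2} (k : ℕ)
    (h : ∃ C : ℝ, ∀ n, m ≤ n → (2 * (n : ℝ) + 1) ^ (k + 1) * |coeff m n u| ≤ C) :
    u ∈ H m k := by
  obtain ⟨C, hC⟩ := h
  have hs := (summable_const_div_sq (C ^ 2)).comp_injective
    (Subtype.val_injective : Function.Injective (Subtype.val : Set.Ici m → ℕ))
  refine Summable.of_nonneg_of_le (fun n => by positivity) (fun n => ?_) hs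
  rw [Function.comp, le_div_iff₀ (by positivity)]
  calc (2 * ((n : ℕ) : ℝ) + 1) ^ (2 * k) * |coeff m n u| ^ 2 * (2 * ((n : ℕ) : ℝ) + 1) ^ 2
      = ((2 * ((n : ℕ) : ℝ) + 1) ^ (k + 1) * |coeff m n u|) ^ 2 := by ring
    _ ≤ C ^ 2 := pow_le_pow_left₀ (by positivity) (hC n n.2) 2

theorem coeff_decay_of_mem_H {m k : ℕ} {u : L2} (hu : u ∈ H m k) :
    ∃ C : ℝ, ∀ n, m ≤ n → (2 * (n : ℝ) + 1) ^ k * |coeff m n u| ≤ C := by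
  refine ⟨√(∑' n : Set.Ici m, (2 * ((n : ℕ) : ℝ) + 1) ^ (2 * k) * |coeff m (n : ℕ) u| ^ 2),
    fun n hn => Real.le_sqrt_of_sq_le ?_⟩
  have h := Summable.le_tsum hu ⟨n, hn⟩ fun i _ => by positivity
  refine le_trans (le_of_eq ?_) h
  simp only
  ring

/-! ### Termwise differentiation of Legendre series -/

/-- A function that agrees with the polynomial `p` on `[-1, 1]`
and is affine on each side of that interval. -/
noncomputable def affineExtension (p : ℝ[X]) (x : ℝ) : ℝ :=
  p.eval (-1) + ∫ y in (-1 : ℝ)..x,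
    (derivative p).eval (Set.projIcc (-1 : ℝ) 1 (by norm_num) y : ℝ)

theorem hasDerivAt_affineExtension (p : ℝ[X]) (x : ℝ) :
    HasDerivAt (affineExtension p)
      ((derivative p).eval (Set.projIcc (-1 : ℝ) 1 (by norm_num) x : ℝ)) x := by
  have hc : Continuous fun y =>
      (derivative p).eval (Set.projIcc (-1 : ℝ) 1 (by norm_num) y : ℝ) :=
    (derivative p).continuous.comp (continuous_subtype_val.comp continuous_projIcc)
  exact (hc.integral_hasStrictDerivAt (-1) x).hasDerivAt.const_add _

theorem affineExtension_eq (p : ℝ[X]) {x : ℝ} (hx : x ∈ Set.Icc (-1 : ℝ) 1) :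
    affineExtension p x = p.eval x := by
  have h : ∫ y in (-1 : ℝ)..x, (derivative p).eval (Set.projIcc (-1 : ℝ) 1 (by norm_num) y : ℝ)
      = ∫ y in (-1 : ℝ)..x, (derivative p).eval y := by
    refine intervalIntegral.integral_congr fun y hy => ?_
    rw [Set.uIcc_of_le hx.1] at hy
    rw [Set.projIcc_of_mem _ ⟨hy.1, hy.2.trans hx.2⟩]
  rw [affineExtension, h, intervalIntegral.integral_eq_sub_of_hasDerivAt
    (fun t _ => p.hasDerivAt t) ((derivative p).continuous.intervalIntegrable _ _)]
  ring

/-- `hasDerivAt_tsum` wants derivative bounds on all of `ℝ`. Affine extensions supply them, since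
their derivatives take only values attained on `[-1,1]`. -/
theorem hasDerivWithinAt_tsum_eval {p : ℕ → ℝ[X]} {v : ℕ → ℝ} (hv : Summable v)
    (hp : ∀ i, ∀ t ∈ Set.Icc (-1 : ℝ) 1, |(derivative (p i)).eval t| ≤ v i)
    (hs : ∀ t ∈ Set.Icc (-1 : ℝ) 1, Summable fun i => (p i).eval t)
    {t : ℝ} (ht : t ∈ Set.Icc (-1 : ℝ) 1) :
    HasDerivWithinAt (fun s => ∑' i, (p i).eval s) (∑' i, (derivative (p i)).eval t)
      (Set.Icc (-1) 1) t := by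
  have h := hasDerivAt_tsum (y₀ := t) hv (fun i y => hasDerivAt_affineExtension (p i) y)
    (fun i y => hp i _ (Subtype.property _))
    (by simpa only [affineExtension_eq _ ht] using hs t ht) t
  rw [Set.projIcc_of_mem _ ht] at h
  exact h.hasDerivWithinAt.congr
    (fun y hy => tsum_congr fun i => (affineExtension_eq (p i) hy).symm)
    (tsum_congr fun i => (affineExtension_eq (p i) ht).symm)

/-- The sum `∑ b_i P_{m+i}^{(m+j)}`. -/
noncomputable def legendreSeries (m : ℕ) (b : ℕ → ℝ) (j : ℕ) (t : ℝ) : ℝ :=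
  ∑' i, (C (b i) * legendreD (m + j) (m + i)).eval t

/-- Decay of `b` faster than every power of `2 (m + i) + 1`. -/
def RapidDecay (m : ℕ) (b : ℕ → ℝ) : Prop :=
  ∀ k : ℕ, ∃ B : ℝ, ∀ i : ℕ, (2 * ((m + i : ℕ) : ℝ) + 1) ^ k * |b i| ≤ B

theorem exists_summable_bound {m : ℕ} {b : ℕ → ℝ}
    (hb : RapidDecay m b) (j : ℕ) :
    ∃ v : ℕ → ℝ, Summable v ∧ ∀ i, ∀ t ∈ Set.Icc (-1 : ℝ) 1,
      |(C (b i) * legendreD (m + j) (m + i)).eval t| ≤ v i := by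
  -- `2 * (m + j)` absorbs the bound on `P_{m+i}^{(m+j)}`; the other `2` makes the majorant
  -- summable.
  obtain ⟨B, hB⟩ := hb (2 * (m + j) + 2)
  refine ⟨fun i => B / (2 * ((m + i : ℕ) : ℝ) + 1) ^ 2,
    (summable_const_div_sq B).comp_injective (add_right_injective m), fun i t ht => ?_⟩
  rw [eval_mul, eval_C, abs_mul, le_div_iff₀ (by positivity)]
  calc |b i| * |(legendreD (m + j) (m + i)).eval t| * (2 * ((m + i : ℕ) : ℝ) + 1) ^ 2
      ≤ |b i| * (2 * ((m + i : ℕ) : ℝ) + 1) ^ (2 * (m + j)) * (2 * ((m + i : ℕ) : ℝ) + 1) ^ 2 := by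
        gcongr
        exact abs_eval_legendreD_le _ _ ht
    _ = (2 * ((m + i : ℕ) : ℝ) + 1) ^ (2 * (m + j) + 2) * |b i| := by ring
    _ ≤ B := hB i

theorem summable_eval_legendreD {m : ℕ} {b : ℕ → ℝ} (hb : RapidDecay m b)
    (j : ℕ) {t : ℝ} (ht : t ∈ Set.Icc (-1 : ℝ) 1) :
    Summable fun i => (C (b i) * legendreD (m + j) (m + i)).eval t := by
  obtain ⟨v, hv, hle⟩ := exists_summable_bound hb j
  exact hv.of_norm_bounded fun i => hle i t ht

theorem hasDerivWithinAt_legendreSeries {m : ℕ} {b : ℕ → ℝ} (hb : RapidDecay m b)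
    (j : ℕ) {t : ℝ} (ht : t ∈ Set.Icc (-1 : ℝ) 1) :
    HasDerivWithinAt (legendreSeries m b j) (legendreSeries m b (j + 1) t)
      (Set.Icc (-1) 1) t := by
  obtain ⟨v, hv, hle⟩ := exists_summable_bound hb (j + 1)
  have e : ∀ i, derivative (C (b i) * legendreD (m + j) (m + i))
      = C (b i) * legendreD (m + (j + 1)) (m + i) := fun i => by
    rw [derivative_C_mul, derivative_legendreD, add_assoc]
  have h := hasDerivWithinAt_tsum_eval (p := fun i => C (b i) * legendreD (m + j) (m + i)) hv
    (by simpa only [e] using hle) (fun s hs => summable_eval_legendreD hb j hs) ht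
  simp only [e] at h
  exact h

theorem contDiffOn_legendreSeries {m : ℕ} {b : ℕ → ℝ} (hb : RapidDecay m b) (j : ℕ) :
    ContDiffOn ℝ ∞ (legendreSeries m b j) (Set.Icc (-1) 1) := by
  refine contDiffOn_infty.2 fun N => ?_
  induction N generalizing j with
  | zero =>
    exact contDiffOn_zero.2 fun t ht =>
      (hasDerivWithinAt_legendreSeries hb j ht).continuousWithinAt
  | succ N ih =>
    rw [Nat.cast_succ, contDiffOn_succ_iff_derivWithin uniqueDiffOn_Icc_neg_one_one]
    refine ⟨fun t ht => (hasDerivWithinAt_legendreSeries hb j ht).differentiableWithinAt,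
      by simp, (ih (j + 1)).congr fun t ht => ?_⟩
    exact (hasDerivWithinAt_legendreSeries hb j ht).derivWithin
      (uniqueDiffOn_Icc_neg_one_one t ht)

theorem pairing_legendreSeries {m : ℕ} {b : ℕ → ℝ} (hb : RapidDecay m b) (l : ℕ) :
    pairing m (m + l) (legendreSeries m b 0)
      = b l * pairing m (m + l) fun t => (legendreD m (m + l)).eval t := by
  obtain ⟨v, hv, hle⟩ := exists_summable_bound hb 0
  set w : ℝ → ℝ := fun t => (1 - t ^ 2) ^ m with hw
  have hwc : Continuous w := by fun_prop
  have hdc : Continuous fun t => |w t * (legendreD m (m + l)).eval t| :=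
    (hwc.mul (legendreD m (m + l)).continuous).abs
  have h := intervalIntegral.hasSum_integral_of_dominated_convergence (μ := volume)
    (a := -1) (b := 1)
    (F := fun i t => w t * (C (b i) * legendreD m (m + i)).eval t * (legendreD m (m + l)).eval t)
    (f := fun t => w t * legendreSeries m b 0 t * (legendreD m (m + l)).eval t)
    (fun i t => |w t * (legendreD m (m + l)).eval t| * v i)
    (fun i => ((hwc.mul (Polynomial.continuous _)).mul
      (Polynomial.continuous _)).aestronglyMeasurable)
    (fun i => Filter.Eventually.of_forall fun t ht => ?_)
    (Filter.Eventually.of_forall fun t _ => hv.mul_left _)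
    (by
      simp only [tsum_mul_left]
      exact (hdc.mul continuous_const).intervalIntegrable _ _)
    (Filter.Eventually.of_forall fun t ht => ?_)
  · have hterm : ∀ i, ∫ t in (-1 : ℝ)..1,
        w t * (C (b i) * legendreD m (m + i)).eval t * (legendreD m (m + l)).eval t
        = b i * pairing m (m + l) fun t => (legendreD m (m + i)).eval t := fun i => by
      rw [pairing, ← intervalIntegral.integral_const_mul]
      refine intervalIntegral.integral_congr fun t _ => ?_
      simp only [eval_mul, eval_C, hw]
      ring
    simp only [hterm] at h
    refine h.unique (hasSum_single l fun i hi => ?_)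
    rw [pairing_legendreD_of_ne (by omega), mul_zero]
  · rw [Set.uIoc_of_le (by norm_num)] at ht
    have := hle i t (Set.Ioc_subset_Icc_self ht)
    rw [add_zero] at this
    rw [Real.norm_eq_abs, mul_right_comm, abs_mul]
    gcongr
  · rw [Set.uIoc_of_le (by norm_num)] at ht
    exact ((summable_eval_legendreD hb 0 (Set.Ioc_subset_Icc_self ht)).hasSum.mul_left _).mul_right _

/-! ### Completeness -/

theorem ae_mem_Ioo : ∀ᵐ t ∂mu, t ∈ Set.Ioo (-1 : ℝ) 1 := ae_restrict_mem measurableSet_Ioo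

instance isFiniteMeasure_mu : IsFiniteMeasure mu :=
  ⟨by simp [mu]⟩

theorem integrable_mul_of_continuousOn {h φ : ℝ → ℝ} (hh : Integrable h mu)
    (hφ : ContinuousOn φ (Set.Icc (-1) 1)) : Integrable (fun t => h t * φ t) mu := by
  obtain ⟨M, hM⟩ := isCompact_Icc.exists_bound_of_continuousOn hφ
  refine hh.mul_bdd (c := M) ?_ ?_
  · exact (hφ.mono Set.Ioo_subset_Icc_self).aestronglyMeasurable measurableSet_Ioo
  · filter_upwards [ae_mem_Ioo] with t ht
    exact hM t (Set.Ioo_subset_Icc_self ht)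

/-- By Weierstrass approximation on `[-1,1]`, `h` also annihilates every smooth test function. -/
theorem ae_eq_zero_of_integral_mul_polynomial {h : ℝ → ℝ} (hh : Integrable h mu)
    (hp : ∀ p : ℝ[X], ∫ t, h t * p.eval t ∂mu = 0) : ∀ᵐ t ∂mu, h t = 0 := by
  refine ae_eq_zero_of_integral_contDiff_smul_eq_zero hh.locallyIntegrable fun φ hφ _ => ?_
  simp only [smul_eq_mul, mul_comm (φ _)]
  have hφc := hφ.continuous
  refine abs_nonpos_iff.1 (le_of_forall_pos_le_add fun ε hε => ?_)
  set M := ∫ t, |h t| ∂mu with hM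
  have hM0 : 0 ≤ M := integral_nonneg fun t => abs_nonneg _
  obtain ⟨p, hpφ⟩ := exists_polynomial_near_of_continuousOn (-1) 1 φ hφc.continuousOn
    (ε / (M + 1)) (by positivity)
  have e : ∫ t, h t * φ t ∂mu = ∫ t, h t * (φ t - p.eval t) ∂mu := by
    simp only [mul_sub]
    rw [integral_sub (integrable_mul_of_continuousOn hh hφc.continuousOn)
      (integrable_mul_of_continuousOn hh p.continuousOn), hp, sub_zero]
  rw [e, zero_add]
  calc |∫ t, h t * (φ t - p.eval t) ∂mu| ≤ ∫ t, |h t| * (ε / (M + 1)) ∂mu := by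
        refine norm_integral_le_of_norm_le (f := fun t => h t * (φ t - p.eval t)) (hh.abs.mul_const _) ?_
        filter_upwards [ae_mem_Ioo] with t ht
        rw [Real.norm_eq_abs, abs_mul, abs_sub_comm]
        gcongr
        exact (hpφ t (Set.Ioo_subset_Icc_self ht)).le
    _ = M * (ε / (M + 1)) := integral_mul_const _ _
    _ ≤ ε := by
        rw [mul_div_assoc', div_le_iff₀ (by positivity)]
        nlinarith

theorem continuous_omega : Continuous omega := by
  unfold omega
  fun_prop

theorem omega_pos {t : ℝ} (ht : t ∈ Set.Ioo (-1 : ℝ) 1) : 0 < omega t :=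
  Real.sqrt_pos.2 (by nlinarith [ht.1, ht.2])

theorem normConst_ne_zero {m n : ℕ} (h : m ≤ n) : normConst n m ≠ 0 := fun h0 => by
  simpa [h0] using normConst_sq_mul_pairing_self h

theorem integral_legendreD_eq_of_coeff_eq {m n : ℕ} (h : m ≤ n) {u : L2} {g : ℝ → ℝ}
    (hc : coeff m n u = normConst n m * pairing m n g) :
    ∫ t, u t * omega t ^ m * (legendreD m n).eval t ∂mu
      = ∫ t, omega t ^ m * g t * omega t ^ m * (legendreD m n).eval t ∂mu := by
  refine mul_left_cancel₀ (normConst_ne_zero h) ?_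
  calc normConst n m * ∫ t, u t * omega t ^ m * (legendreD m n).eval t ∂mu
      = coeff m n u := by
        rw [coeff, ← integral_const_mul]
        refine integral_congr_ae (Filter.Eventually.of_forall fun t => ?_)
        simp only [legendreQ, assocLegendre, legendreD]
        ring
    _ = normConst n m * pairing m n g := hc
    _ = _ := by
        rw [pairing, ← integral_mu]
        congr 1
        refine integral_congr_ae ?_
        filter_upwards [ae_mem_Ioo] with t ht
        rw [← omega_sq (Set.Ioo_subset_Icc_self ht)]
        ring

/-- Multiplying `u - ω^m g` by `ω^m` gives a function orthogonal to each `P_{m+i}^{(m)}`. These have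
degrees `0, 1, 2, …` and span all polynomials; finally `ω > 0` inside the interval is cancelled. -/
theorem ae_eq_of_coeff_eq {m : ℕ} {u : L2} {g : ℝ → ℝ} (hg : ContinuousOn g (Set.Icc (-1) 1))
    (hc : ∀ n, m ≤ n → coeff m n u = normConst n m * pairing m n g) :
    (u : ℝ → ℝ) =ᵐ[mu] fun t => omega t ^ m * g t := by
  have hω : ContinuousOn (fun t => omega t ^ m) (Set.Icc (-1) 1) :=
    (continuous_omega.pow m).continuousOn
  have hu : Integrable (fun t => u t * omega t ^ m) mu :=
    integrable_mul_of_continuousOn ((Lp.memLp u).integrable one_le_two) hω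
  have hg' : Integrable (fun t => omega t ^ m * g t * omega t ^ m) mu := by
    simpa using integrable_mul_of_continuousOn (integrable_const (1 : ℝ)) ((hω.mul hg).mul hω)
  have key := ae_eq_zero_of_integral_mul_polynomial (hu.sub hg') fun p => ?_
  · filter_upwards [key, ae_mem_Ioo] with t h ht
    have h' : (u t - omega t ^ m * g t) * omega t ^ m = 0 := by
      rw [← h, Pi.sub_apply]
      ring
    exact sub_eq_zero.1 ((mul_eq_zero.1 h').resolve_right (pow_pos (omega_pos ht) m).ne')
  · have hint := fun q : ℝ[X] => integrable_mul_of_continuousOn (hu.sub hg')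
      (φ := fun t => q.eval t) q.continuousOn
    have hmem : p ∈ Submodule.span ℝ (Set.range (legendreDSequence m)) := by
      rw [(legendreDSequence m).span (isUnit_leadingCoeff_legendreDSequence m)]
      trivial
    induction hmem using Submodule.span_induction with
    | mem q hq =>
      obtain ⟨i, rfl⟩ := hq
      simp only [legendreDSequence_apply, Pi.sub_apply, sub_mul]
      rw [integral_sub (integrable_mul_of_continuousOn hu (Polynomial.continuousOn _))
        (integrable_mul_of_continuousOn hg' (Polynomial.continuousOn _)), sub_eq_zero]
      exact integral_legendreD_eq_of_coeff_eq (by omega) (hc _ (by omega))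
    | zero => simp
    | add q r _ _ hq hr =>
      simp only [eval_add, mul_add]
      rw [integral_add (hint q) (hint r), hq, hr, add_zero]
    | smul c q _ hq =>
      simp only [eval_smul, smul_eq_mul, mul_left_comm _ c]
      rw [integral_const_mul, hq, mul_zero]

/-! ### Reconstruction and conclusion -/

theorem mem_omegaSmooth_of_coeff_decay {m : ℕ} {u : L2}
    (h : ∀ k : ℕ, ∃ B : ℝ, ∀ n, m ≤ n → (2 * (n : ℝ) + 1) ^ k * |coeff m n u| ≤ B) :
    u ∈ omegaSmooth m := by
  -- With this factor, `ω^m ∑ b_i P_{m+i}^{(m)}` is the expansion `∑ (u, Q_n^m) Q_n^m`.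
  set b : ℕ → ℝ := fun i => coeff m (m + i) u * normConst (m + i) m with hbdef
  have hb : RapidDecay m b := fun k => by
    obtain ⟨B, hB⟩ := h (k + 1)
    refine ⟨B, fun i => ?_⟩
    rw [hbdef, abs_mul, abs_of_nonneg (normConst_nonneg _ _)]
    calc (2 * ((m + i : ℕ) : ℝ) + 1) ^ k * (|coeff m (m + i) u| * normConst (m + i) m)
        ≤ (2 * ((m + i : ℕ) : ℝ) + 1) ^ k
            * (|coeff m (m + i) u| * (2 * ((m + i : ℕ) : ℝ) + 1)) := by
          gcongr
          exact normConst_le _ _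
      _ = (2 * ((m + i : ℕ) : ℝ) + 1) ^ (k + 1) * |coeff m (m + i) u| := by ring
      _ ≤ B := hB _ (by omega)
  have hg := contDiffOn_legendreSeries hb 0
  refine ⟨legendreSeries m b 0, hg, ae_eq_of_coeff_eq hg.continuousOn fun n hn => ?_⟩
  obtain ⟨l, rfl⟩ := Nat.exists_eq_add_of_le hn
  rw [pairing_legendreSeries hb, hbdef]
  linear_combination (-coeff m (m + l) u) * normConst_sq_mul_pairing_self hn

end LegendreScale

theorem mainTheorem10 (m : ℕ) :
    (⋂ (k : ℕ) (_ : 1 ≤ k), LegendreScale.H m k) = LegendreScale.omegaSmooth m := by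
  ext u
  simp only [Set.mem_iInter]
  constructor
  · intro hu
    refine LegendreScale.mem_omegaSmooth_of_coeff_decay fun k => ?_
    -- The intersection starts at `1`, so `k + 1` also covers `k = 0`.
    obtain ⟨B, hB⟩ := LegendreScale.coeff_decay_of_mem_H (hu (k + 1) (by omega))
    refine ⟨B, fun n hn => le_trans ?_ (hB n hn)⟩
    gcongr
    · linarith [(Nat.cast_nonneg n : (0 : ℝ) ≤ n)]
    · omega
  · intro hu k _
    exact LegendreScale.mem_H_of_coeff_decay k
      (LegendreScale.coeff_decay_of_mem_omegaSmooth hu (k + 1))
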